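/- A system $(X,T)$ is a compact metric space $X$ (with metric $\rho$) with a homeomorphism $T:X\to X$; it is minimal if every orbit $\{T^nx:n\in\mathbb Z\}$ is dense, transitive if for all nonempty open $U,V\subseteq X$ there is $n\in\mathbb Z$ with $U\cap T^{-n}V\neq\emptyset$, and distal if $\inf_{n\in\mathbb Z}\rho(T^nx,T^ny)=0$ only for $x=y$. A factor map is a continuous surjection intertwining the two homeomorphisms. For $d\ge 1$ write $X^{[d]}=X^{\{0,1\}^d}$ and $X^{[d]}_*=X^{\{0,1\}^d\setminus\{\mathbf 0\}}$, let $p_*:X^{[d]}\to X^{[d]}_*$ be the projection, and put $x^{[d]}=(x,\dots,x)\in X^{[d]}$, $x^{[d]}_*=p_*(x^{[d]})$; for $\pi:X\to Z$ let $\pi^{[d]}_*:X^{[d]}_*\to Z^{[d]}_*$ be $\pi$ in every coordinate. The face group $\mathcal F^{[d]}$ is the group of transformations of $X^{[d]}$ generated by $T^{[d]}_1,\dots,T^{[d]}_d$, where $T^{[d]}_j$ applies $T$ to the coordinates $\epsilon$ with $\epsilon_j=1$ and fixes the other coordinates; $\mathcal F^{[d]}_*$ is the group of transformations it induces on $X^{[d]}_*$.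 Closed orbits under these groups are written $\overline{\mathcal F^{[d]}}(\cdot)$ and $\overline{\mathcal F^{[d]}_*}(\cdot)$. Let $\mathcal Q^{[d]}(X)$ be the closure in $X^{[d]}$ of $\{(T^{n_1\epsilon_1+\dots+n_d\epsilon_d}x)_{\epsilon\in\{0,1\}^d}: x\in X,\ n_1,\dots,n_d\in\mathbb Z\}$. A system of order $d-1$ (also called a $(d-1)$-step pro-nilsystem) is a transitive system $(X,T)$ such that $(x,y,\dots,y)\in\mathcal Q^{[d]}(X)$ (with $x$ at the vertex $\mathbf 0$) implies $x=y$. The maximal $(d-1)$-step pro-nilfactor of $(X,T)$ is the factor $Z_{d-1}$ of $(X,T)$ that is a system of order $d-1$ and through which every factor map from $(X,T)$ to a system of order $d-1$ factors. **Corollary.** Let $(X,T)$ be a minimal distal system, let $d\ge 1$, and let $\pi:(X,T)\to(Z_{d-1},T)$ be the factor map to the maximal $(d-1)$-step pro-nilfactor. Then for every $x\in X$, with $y=\pi(x)$, $$\overline{\mathcal F^{[d]}}(x^{[d]})=\{x\}\times(\pi^{[d]}_*)^{-1}\bigl(\overline{\mathcal F^{[d]}_*}(y^{[d]}_*)\bigr),$$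 where the factor $\{x\}$ is the coordinate at $\mathbf 0$. In particular, for every $x\in X$ the set $F_x=p_*\bigl(\overline{\mathcal F^{[d]}}(x^{[d]})\bigr)$ is $\pi^{[d]}_*$-saturated, i.e. $F_x=(\pi^{[d]}_*)^{-1}(\pi^{[d]}_*(F_x))$; hence $Z_{d-1}$ is the topological cubic characteristic factor of order $d$ of $(X,T)$, i.e. there is a dense $G_\delta$ set $X_0\subseteq X$ such that $F_x$ is $\pi^{[d]}_*$-saturated for all $x\in X_0$. -/

import Mathlib

/-! Topological dynamical systems: a homeomorphism `T : X ≃ₜ X` of a compact metric space `X`.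
Powers `T ^ n`, `n : ℤ`, are taken in the group of self-homeomorphisms of `X`. -/

namespace CubicDyn

/-- `(X, T)` is minimal: every two-sided orbit is dense. -/
def IsMinimalSystem {X : Type*} [TopologicalSpace X] (T : X ≃ₜ X) : Prop :=
  ∀ x : X, closure (Set.range fun n : ℤ => (T ^ n) x) = Set.univ

/-- `(X, T)` is transitive: for nonempty open `U`, `V` some `U ∩ T⁻ⁿ V` is nonempty. -/
def IsTransitiveSystem {X : Type*} [TopologicalSpace X] (T : X ≃ₜ X) : Prop :=
  ∀ U V : Set X, IsOpen U → IsOpen V → U.Nonempty → V.Nonempty →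
    ∃ n : ℤ, (U ∩ (fun x => (T ^ n) x) ⁻¹' V).Nonempty

/-- The proximal relation `P(X, T)`: the pairs with `inf_n d(Tⁿ x, Tⁿ y) = 0`. -/
def proximalRel {X : Type*} [MetricSpace X] (T : X ≃ₜ X) : Set (X × X) :=
  {p | ⨅ n : ℤ, dist ((T ^ n) p.1) ((T ^ n) p.2) = 0}

/-- `(X, T)` is distal: only the diagonal pairs are proximal. -/
def IsDistalSystem {X : Type*} [MetricSpace X] (T : X ≃ₜ X) : Prop :=
  proximalRel T = Set.diagonal X

/-- `π : (X, T) → (Y, S)` is a factor map: continuous, onto, and intertwining the actions. -/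
structure IsFactorMap {X Y : Type*} [TopologicalSpace X] [TopologicalSpace Y]
    (T : X ≃ₜ X) (S : Y ≃ₜ Y) (π : X → Y) : Prop where
  continuous : Continuous π
  surjective : Function.Surjective π
  intertwines : ∀ x, π (T x) = S (π x)

/-- The vertex set `{0,1}^d` of the discrete cube. -/
abbrev Cube (d : ℕ) : Type := Fin d → Fin 2

/-- `{0,1}^d` without the vertex `(0, …, 0)`. -/
abbrev CubeStar (d : ℕ) : Type := {ε : Cube d // ε ≠ 0}

/-- `n · ε = ∑ i, n_i ε_i`. -/
def dotCube {d : ℕ} (n : Fin d → ℤ) (ε : Cube d) : ℤ :=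
  ∑ i, n i * ((ε i : ℕ) : ℤ)

/-- The projection `p_* : X^{[d]} → X^{[d]}_*` forgetting the coordinate at `(0, …, 0)`. -/
def starProj {X : Type*} {d : ℕ} (z : Cube d → X) : CubeStar d → X :=
  fun ε => z ε.1

/-- The set `Q^{[d]}(X)` of dynamical parallelepipeds of dimension `d`. -/
def parallelepipeds {X : Type*} [TopologicalSpace X] (T : X ≃ₜ X) (d : ℕ) :
    Set (Cube d → X) :=
  closure {z | ∃ (n : Fin d → ℤ) (x : X), z = fun ε => (T ^ dotCube n ε) x}

/-- The face transformation `T_j^{[d]}` of `X^{[d]}`: it applies `T` to the coordinates `ε`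
with `ε_j = 1` and fixes the others. -/
def faceMap {X : Type*} [TopologicalSpace X] (T : X ≃ₜ X) {d : ℕ} (j : Fin d) :
    (Cube d → X) ≃ₜ (Cube d → X) :=
  Homeomorph.piCongrRight fun ε => if ε j = 1 then T else Homeomorph.refl X

/-- The transformation of `X^{[d]}_*` induced by the face transformation `T_j^{[d]}`. -/
def faceMapStar {X : Type*} [TopologicalSpace X] (T : X ≃ₜ X) {d : ℕ} (j : Fin d) :
    (CubeStar d → X) ≃ₜ (CubeStar d → X) :=
  Homeomorph.piCongrRight fun ε => if ε.1 j = 1 then T else Homeomorph.refl X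

/-- The face group `F^{[d]}`, generated by the face transformations of `X^{[d]}`. -/
def faceGroup {X : Type*} [TopologicalSpace X] (T : X ≃ₜ X) (d : ℕ) :
    Subgroup ((Cube d → X) ≃ₜ (Cube d → X)) :=
  Subgroup.closure (Set.range fun j : Fin d => faceMap T j)

/-- The group `F^{[d]}_*` of transformations of `X^{[d]}_*` induced by the face group. -/
def faceGroupStar {X : Type*} [TopologicalSpace X] (T : X ≃ₜ X) (d : ℕ) :
    Subgroup ((CubeStar d → X) ≃ₜ (CubeStar d → X)) :=
  Subgroup.closure (Set.range fun j : Fin d => faceMapStar T j)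

/-- The closure of the orbit of `y` under a group `H` of homeomorphisms. -/
def orbitClosure {Y : Type*} [TopologicalSpace Y] (H : Subgroup (Y ≃ₜ Y)) (y : Y) : Set Y :=
  closure {w | ∃ S ∈ H, w = S y}

/-- The closed orbit of `x^{[d]} = (x, …, x)` under `F^{[d]}`. -/
def faceOrbitClosure {X : Type*} [TopologicalSpace X] (T : X ≃ₜ X) (d : ℕ) (x : X) :
    Set (Cube d → X) :=
  orbitClosure (faceGroup T d) fun _ => x

/-- The closed orbit of `x^{[d]}_* = (x, …, x)` under `F^{[d]}_*`. -/
def faceOrbitClosureStar {X : Type*} [TopologicalSpace X] (T : X ≃ₜ X) (d : ℕ) (x : X) :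
    Set (CubeStar d → X) :=
  orbitClosure (faceGroupStar T d) fun _ => x

/-- `{x} × A ⊆ X^{[d]}`, for `A ⊆ X^{[d]}_*`, where `x` sits at the coordinate `(0, …, 0)`. -/
def singletonProd {X : Type*} {d : ℕ} (x : X) (A : Set (CubeStar d → X)) :
    Set (Cube d → X) :=
  {z | z 0 = x ∧ starProj z ∈ A}

/-- The map `π^{[d]}_* : X^{[d]}_* → Y^{[d]}_*`, applying `π` to every coordinate. -/
def starMap {X Y : Type*} (π : X → Y) (d : ℕ) : (CubeStar d → X) → (CubeStar d → Y) :=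
  fun z ε => π (z ε)

/-- `L` is saturated with respect to `f`: `L = f⁻¹(f(L))`. -/
def IsSaturated {A B : Type*} (f : A → B) (L : Set A) : Prop :=
  L = f ⁻¹' (f '' L)

/-- A system of order `k`, also called a `k`-step pro-nilsystem: a transitive system such that
`(x, y, …, y) ∈ Q^{[k+1]}(X)` only for `x = y`. -/
def IsSystemOfOrder {X : Type*} [TopologicalSpace X] (T : X ≃ₜ X) (k : ℕ) : Prop :=
  IsTransitiveSystem T ∧
    ∀ x y : X, (fun ε : Cube (k + 1) => if ε = 0 then x else y) ∈ parallelepipeds T (k + 1) →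
      x = y

/-- `π : (X, T) → (Z, S)` is the factor map to the maximal factor of order `k` (the maximal
`k`-step pro-nilfactor): `(Z, S)` has order `k`, and every factor of `(X, T)` of order `k` is a
factor of `(Z, S)`, compatibly with the maps from `X`. Every factor of `X` is isomorphic to one
whose space is a quotient of `X`, so it is enough to let `W` range over the universe of `X`. -/
def IsMaximalFactorOfOrder.{u, v} {X : Type u} {Z : Type v} [MetricSpace X] [MetricSpace Z]
    (T : X ≃ₜ X) (S : Z ≃ₜ Z) (π : X → Z) (k : ℕ) : Prop :=
  IsFactorMap T S π ∧ IsSystemOfOrder S k ∧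
    ∀ (W : Type u) [MetricSpace W] [CompactSpace W] (R : W ≃ₜ W) (φ : X → W),
      IsFactorMap T R φ → IsSystemOfOrder R k →
        ∃ ψ : Z → W, IsFactorMap S R ψ ∧ ψ ∘ π = φ

/-- `(Y, S)` is, through `π`, a topological cubic characteristic factor of order `d` of `(X, T)`:
for all `x` in a dense `G_δ` set, the projection to `X^{[d]}_*` of the closed `F^{[d]}`-orbit of
`x^{[d]}` is saturated with respect to `π^{[d]}_*`. -/
def IsCubicCharacteristicFactor {X Y : Type*} [TopologicalSpace X] [TopologicalSpace Y]
    (T : X ≃ₜ X) (S : Y ≃ₜ Y) (π : X → Y) (d : ℕ) : Prop :=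
  IsFactorMap T S π ∧
    ∃ X₀ : Set X, IsGδ X₀ ∧ Dense X₀ ∧
      ∀ x ∈ X₀, IsSaturated (starMap π d) (starProj '' faceOrbitClosure T d x)

end CubicDyn

namespace CubicDyn

open Set Topology

/-! Call $x,y$ regionally proximal if $(x,y,\dots,y)\in\mathcal Q^{[d]}(X)$. For a minimal distal
system two facts carry the theorem. (1) Every vertex of a parallelepiped may be changed within its
regionally proximal class (`mem_parallelepipeds_of_regProximal`). Hence regional proximality is a
closed invariant equivalence relation whose quotient has order $d-1$, and by maximality of $Z_{d-1}$
points with the same image under $\pi$ are regionally proximal. (2) The parallelepipeds with vertex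
$x$ at $\mathbf 0$ all lie in the closed face orbit of $x^{[d]}$ (`mem_orbitHull_faceHom`). If
$z_{\mathbf 0}=x$ and $\pi^{[d]}_*(p_*z)$ lies in the closed orbit of $y^{[d]}_*$, then the image of
$z$ in $Z_{d-1}^{[d]}$ is a parallelepiped. It lifts to a parallelepiped of $X$ with the same
$\pi$-images as $z$, so $z$ is a parallelepiped by (1) and lies in the closed face orbit by (2). The
other inclusion is equivariance.

Distality enters through `mem_orbitHull_symm`: closed orbits in powers of $X$ are minimal. This lets
parallelepipeds be glued along a common face (`glue_mem_parallelepipeds`). Fact (1) is repeated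
gluing; fact (2) combines gluing with a Baire category argument. -/

/-- The coordinatewise action of an integer vector through powers of `T`. -/
def powAct {X : Type*} [TopologicalSpace X] (T : X ≃ₜ X) {ι : Type*} (a : ι → ℤ) (z : ι → X) :
    ι → X :=
  fun i => (T ^ a i) (z i)

/-- The closure of the orbit of `z` under a group acting by integer vectors. -/
def orbitHull {X : Type*} [TopologicalSpace X] (T : X ≃ₜ X) {ι P : Type*} [AddCommGroup P]
    (φ : P →+ (ι → ℤ)) (z : ι → X) : Set (ι → X) :=
  closure (range fun p => powAct T (φ p) z)

/-! ### Closed orbits under groups of integer vectors -/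

section Basic

variable {X : Type*} [TopologicalSpace X] (T : X ≃ₜ X) {ι κ P : Type*} [AddCommGroup P]
  (φ : P →+ (ι → ℤ))

theorem powAct_add (a b : ι → ℤ) (z : ι → X) :
    powAct T (a + b) z = powAct T a (powAct T b z) := by
  funext i
  simp [powAct, zpow_add]

theorem powAct_zero (z : ι → X) : powAct T 0 z = z := by
  funext i
  simp [powAct]

theorem continuous_powAct (a : ι → ℤ) : Continuous (powAct T a) :=
  continuous_pi fun i => (T ^ a i).continuous.comp (continuous_apply i)

theorem powAct_mem_orbitHull (p : P) (z : ι → X) : powAct T (φ p) z ∈ orbitHull T φ z :=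
  subset_closure ⟨p, rfl⟩

theorem self_mem_orbitHull (z : ι → X) : z ∈ orbitHull T φ z := by
  simpa [powAct_zero] using powAct_mem_orbitHull T φ 0 z

theorem orbitHull_subset {z : ι → X} {C : Set (ι → X)} (hC : IsClosed C)
    (h : ∀ p, powAct T (φ p) z ∈ C) : orbitHull T φ z ⊆ C :=
  closure_minimal (by rintro _ ⟨p, rfl⟩; exact h p) hC

theorem powAct_mem_of_mem_orbitHull {z w : ι → X} (h : w ∈ orbitHull T φ z) (p : P) :
    powAct T (φ p) w ∈ orbitHull T φ z := by
  have : orbitHull T φ z ⊆ powAct T (φ p) ⁻¹' orbitHull T φ z :=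
    orbitHull_subset T φ (isClosed_closure.preimage (continuous_powAct T _)) fun q => by
      rw [mem_preimage, ← powAct_add, ← map_add]
      exact powAct_mem_orbitHull T φ _ z
  exact this h

theorem orbitHull_trans {z w v : ι → X} (h : w ∈ orbitHull T φ z) (h' : v ∈ orbitHull T φ w) :
    v ∈ orbitHull T φ z :=
  orbitHull_subset T φ isClosed_closure (powAct_mem_of_mem_orbitHull T φ h) h'

/-- Points of the closure of the image orbit lift to the orbit closure. -/
theorem closure_subset_image_orbitHull [CompactSpace X] {Y : Type*} [TopologicalSpace Y]
    [T2Space Y] {f : (ι → X) → Y} (hf : Continuous f) {z : ι → X} {A : Set Y}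
    (h : ∀ y ∈ A, ∃ p, f (powAct T (φ p) z) = y) : closure A ⊆ f '' orbitHull T φ z := by
  have hc : IsCompact (orbitHull T φ z) := isClosed_closure.isCompact
  refine closure_minimal (fun y hy => ?_) (hc.image hf).isClosed
  obtain ⟨p, rfl⟩ := h y hy
  exact mem_image_of_mem f (powAct_mem_orbitHull T φ p z)

end Basic

/-! ### Symmetry of closed orbits in distal systems -/

section Ellis

variable {X : Type*} [MetricSpace X] [CompactSpace X] (T : X ≃ₜ X) {ι P : Type*}
  [AddCommGroup P] (φ : P →+ (ι → ℤ))

/-- In a distal system, the relation of lying in the orbit closure is symmetric. -/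
theorem mem_orbitHull_symm (hdist : IsDistalSystem T) {z w : ι → X}
    (h : w ∈ orbitHull T φ z) : z ∈ orbitHull T φ w := by
  -- The Ellis semigroup of the action, recorded as tuples of self-maps of `X`; multiplication is
  -- continuous in the left factor only.
  let gen : P → ι → X → X := fun p i x => (T ^ φ p i) x
  let E : Set (ι → X → X) := closure (range gen)
  let _ : Semigroup (ι → X → X) :=
    { mul := fun p q i x => p i (q i x)
      mul_assoc := fun _ _ _ => rfl }
  have mul_def : ∀ p q : ι → X → X, p * q = fun i x => p i (q i x) := fun _ _ => rfl
  have cont_right : ∀ r : ι → X → X, Continuous (· * r) := fun r => by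
    simp only [mul_def]
    fun_prop
  have gen_mul : ∀ p q, gen p * gen q = gen (p + q) := fun p q => by
    funext i x
    simp [mul_def, gen, zpow_add]
  have cont_gen : ∀ p, Continuous (gen p * ·) := fun p => by
    simp only [mul_def, gen]
    refine continuous_pi fun i => continuous_pi fun x => (T ^ φ p i).continuous.comp ?_
    fun_prop
  have gen_mul_mem : ∀ p, ∀ q ∈ E, gen p * q ∈ E := fun p q hq => by
    have : E ⊆ (gen p * ·) ⁻¹' E :=
      closure_minimal (by rintro _ ⟨q, rfl⟩; exact subset_closure ⟨_, (gen_mul p q).symm⟩)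
        (isClosed_closure.preimage (cont_gen p))
    exact this hq
  have mul_mem : ∀ p ∈ E, ∀ q ∈ E, p * q ∈ E := fun p hp q hq => by
    have : E ⊆ (· * q) ⁻¹' E :=
      closure_minimal (by rintro _ ⟨p, rfl⟩; exact gen_mul_mem p q hq)
        (isClosed_closure.preimage (cont_right q))
    exact this hp
  have hE : IsCompact E := isClosed_closure.isCompact
  have cont_eval : ∀ y : ι → X, Continuous fun (p : ι → X → X) i => p i (y i) := fun y => by
    fun_prop
  obtain ⟨p, hp, hpz⟩ : w ∈ (fun (p : ι → X → X) i => p i (z i)) '' E := by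
    refine closure_minimal ?_ (hE.image (cont_eval z)).isClosed h
    rintro _ ⟨p, rfl⟩
    exact ⟨gen p, subset_closure ⟨p, rfl⟩, rfl⟩
  -- The idempotent is sought in the left ideal `E * p` rather than in `E`, so that it has the form
  -- `q * p`; once it is the identity, `q` carries `w` back to `z`.
  obtain ⟨e, ⟨q, hq, hqe⟩, he⟩ := exists_idempotent_in_compact_subsemigroup cont_right
    ((· * p) '' E) ⟨_, mem_image_of_mem _ hp⟩ (hE.image (cont_right p)) (by
      rintro _ ⟨a, ha, rfl⟩ _ ⟨b, hb, rfl⟩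
      exact ⟨a * p * b, mul_mem _ (mul_mem _ ha _ hp) _ hb, by simp only [mul_assoc]⟩)
  have heE : e ∈ E := hqe ▸ mul_mem q hq p hp
  have he_id : ∀ i x, e i x = x := fun i x => by
    have hee : e i (e i x) = e i x := congrFun (congrFun he i) x
    -- Both points have the same image under `e i`, which is a pointwise limit of powers of `T`.
    have hprox : (x, e i x) ∈ proximalRel T := by
      have hnn : ∀ n : ℤ, 0 ≤ dist ((T ^ n) x) ((T ^ n) (e i x)) := fun n => dist_nonneg
      refine le_antisymm (le_of_forall_pos_le_add fun δ hδ => ?_) (le_ciInf hnn)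
      have hcont : Continuous fun f : ι → X → X => dist (f i x) (f i (e i x)) := by fun_prop
      obtain ⟨_, hg, r, rfl⟩ := mem_closure_iff.1 heE _
        (isOpen_lt hcont (continuous_const (y := δ))) (by simpa [hee] using hδ)
      rw [zero_add]
      exact (ciInf_le ⟨0, by rintro _ ⟨n, rfl⟩; exact hnn n⟩ (φ r i)).trans (le_of_lt hg)
    rw [hdist] at hprox
    exact Eq.symm hprox
  have hzq : (fun i => q i (w i)) = z := by
    funext i
    subst hpz
    exact (congrFun (congrFun hqe i) (z i)).trans (he_id i (z i))
  rw [← hzq]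
  have : E ⊆ (fun (p : ι → X → X) i => p i (w i)) ⁻¹' orbitHull T φ w :=
    closure_minimal (by rintro _ ⟨p, rfl⟩; exact powAct_mem_orbitHull T φ p w)
      (isClosed_closure.preimage (cont_eval w))
  exact this hq

end Ellis

/-! ### Affine integer vectors on the cube and dynamical parallelepipeds -/

section DotCube

variable {d : ℕ}

theorem dotCube_add (n m : Fin d → ℤ) (ε : Cube d) :
    dotCube (n + m) ε = dotCube n ε + dotCube m ε := by
  simp [dotCube, add_mul, Finset.sum_add_distrib]

theorem dotCube_zero (ε : Cube d) : dotCube 0 ε = 0 := by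
  simp [dotCube]

theorem dotCube_vertex_zero (n : Fin d → ℤ) : dotCube n 0 = 0 := by
  simp [dotCube]

theorem dotCube_single (k : Fin d) (l : ℤ) (ε : Cube d) :
    dotCube (Pi.single k l) ε = l * ((ε k : ℕ) : ℤ) := by
  rw [dotCube, Finset.sum_eq_single k]
  · simp
  · intro i _ hi
    simp [hi]
  · simp

theorem dotCube_update (n : Fin d → ℤ) (ε : Cube d) (k : Fin d) (e : Fin 2) :
    dotCube n (Function.update ε k e) = dotCube n ε + n k * (((e : ℕ) : ℤ) - ((ε k : ℕ) : ℤ)) := by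
  rw [dotCube, dotCube, ← Finset.add_sum_erase _ _ (Finset.mem_univ k),
    ← Finset.add_sum_erase _ (fun i => n i * ((ε i : ℕ) : ℤ)) (Finset.mem_univ k),
    Finset.sum_congr rfl fun i hi => by
      rw [Function.update_of_ne (Finset.ne_of_mem_erase hi)]]
  simp only [Function.update_self]
  ring

theorem dotCube_cons (n : Fin (d + 1) → ℤ) (e : Fin 2) (ε : Cube d) :
    dotCube n (Fin.cons e ε : Cube (d + 1)) =
      n 0 * ((e : ℕ) : ℤ) + dotCube (fun i => n i.succ) ε := by
  simp [dotCube, Fin.sum_univ_succ]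

/-- The integer vectors `ε ↦ n · ε` of the face group. -/
def faceHom (d : ℕ) : (Fin d → ℤ) →+ (Cube d → ℤ) :=
  AddMonoidHom.mk' (fun n ε => dotCube n ε) fun n m => funext fun ε => dotCube_add n m ε

/-- The integer vectors `ε ↦ m + n · ε`, generated by the face group and the diagonal. -/
def affineHom (d : ℕ) : ℤ × (Fin d → ℤ) →+ (Cube d → ℤ) :=
  AddMonoidHom.mk' (fun p ε => p.1 + dotCube p.2 ε) fun p q => funext fun ε => by
    simp only [Prod.fst_add, Prod.snd_add, dotCube_add, Pi.add_apply]
    ring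

/-- The constant integer vectors. -/
def diagHom (ι : Type*) : ℤ →+ (ι → ℤ) :=
  AddMonoidHom.mk' (fun n _ => n) fun _ _ => rfl

end DotCube

section Parallelepipeds

variable {X : Type*} [TopologicalSpace X] (T : X ≃ₜ X) {d : ℕ}

theorem const_mem_parallelepipeds (x : X) : (fun _ => x) ∈ parallelepipeds T d :=
  subset_closure ⟨0, x, by simp [dotCube_zero]⟩

theorem isClosed_parallelepipeds : IsClosed (parallelepipeds T d) :=
  isClosed_closure

/-- Parallelepipeds are stable under affine reindexings of the cube. -/
theorem comp_mem_parallelepipeds {d' : ℕ} {f : Cube d → Cube d'}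
    (hf : ∀ n, ∃ m n', ∀ ε, dotCube n (f ε) = dotCube n' ε + m) {w : Cube d' → X}
    (hw : w ∈ parallelepipeds T d') : w ∘ f ∈ parallelepipeds T d := by
  have hcont : Continuous fun w : Cube d' → X => w ∘ f :=
    continuous_pi fun ε => continuous_apply (f ε)
  have : parallelepipeds T d' ⊆ (fun w : Cube d' → X => w ∘ f) ⁻¹' parallelepipeds T d := by
    refine closure_minimal ?_ (isClosed_closure.preimage hcont)
    rintro _ ⟨n, x, rfl⟩
    obtain ⟨m, n', h⟩ := hf n
    refine subset_closure ⟨n', (T ^ m) x, ?_⟩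
    funext ε
    simp [h, zpow_add]
  exact this hw

theorem powAct_mem_parallelepipeds {w : Cube d → X} (hw : w ∈ parallelepipeds T d)
    (p : ℤ × (Fin d → ℤ)) : powAct T (affineHom d p) w ∈ parallelepipeds T d := by
  have : parallelepipeds T d ⊆ powAct T (affineHom d p) ⁻¹' parallelepipeds T d := by
    refine closure_minimal ?_ (isClosed_closure.preimage (continuous_powAct T _))
    rintro _ ⟨n, x, rfl⟩
    refine subset_closure ⟨p.2 + n, (T ^ p.1) x, ?_⟩
    funext ε
    simp only [powAct, affineHom, AddMonoidHom.mk'_apply, ← Homeomorph.mul_apply, ← zpow_add,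
      dotCube_add]
    congr 2
    ring
  exact this hw

theorem orbitHull_affineHom_subset {w : Cube d → X} (hw : w ∈ parallelepipeds T d) :
    orbitHull T (affineHom d) w ⊆ parallelepipeds T d :=
  orbitHull_subset T _ isClosed_closure (powAct_mem_parallelepipeds T hw)

theorem orbitHull_faceHom_subset_affineHom (w : Cube d → X) :
    orbitHull T (faceHom d) w ⊆ orbitHull T (affineHom d) w :=
  orbitHull_subset T _ isClosed_closure fun n => by
    have : faceHom d n = affineHom d (0, n) := by
      funext ε
      simp [faceHom, affineHom]
    rw [this]
    exact powAct_mem_orbitHull T _ _ _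

-- Any base point is a limit of points $T^m x$, so the parallelepipeds form a single closed orbit;
-- this makes `mem_orbitHull_symm` applicable to them.
variable {T} in
theorem IsMinimalSystem.parallelepipeds_eq (hmin : IsMinimalSystem T) (x : X) :
    parallelepipeds T d = orbitHull T (affineHom d) fun _ => x := by
  refine Subset.antisymm (closure_minimal ?_ isClosed_closure)
    (orbitHull_affineHom_subset T (const_mem_parallelepipeds T x))
  rintro _ ⟨n, y, rfl⟩
  have hcont : Continuous fun (y : X) (ε : Cube d) => (T ^ dotCube n ε) y :=
    continuous_pi fun ε => (T ^ dotCube n ε).continuous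
  have : closure (range fun m : ℤ => (T ^ m) x) ⊆
      (fun (y : X) (ε : Cube d) => (T ^ dotCube n ε) y) ⁻¹'
        orbitHull T (affineHom d) fun _ => x := by
    refine closure_minimal ?_ (isClosed_closure.preimage hcont)
    rintro _ ⟨m, rfl⟩
    refine subset_closure ⟨(m, n), ?_⟩
    funext ε
    simp [powAct, affineHom, ← Homeomorph.mul_apply, ← zpow_add, add_comm]
  exact this (by rw [hmin x]; trivial)

end Parallelepipeds

section Factor

variable {X Y : Type*} [TopologicalSpace X] [TopologicalSpace Y] {T : X ≃ₜ X} {S : Y ≃ₜ Y}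
  {π : X → Y}

theorem IsFactorMap.zpow_apply (hπ : IsFactorMap T S π) (n : ℤ) (x : X) :
    π ((T ^ n) x) = (S ^ n) (π x) := by
  have hinv : ∀ x, π (T⁻¹ x) = S⁻¹ (π x) := fun x => by
    apply S.injective
    rw [← hπ.intertwines, ← Homeomorph.mul_apply, ← Homeomorph.mul_apply]
    simp
  induction n generalizing x with
  | zero => simp
  | succ n ih => rw [zpow_add_one, zpow_add_one, Homeomorph.mul_apply, ih, hπ.intertwines]; rfl
  | pred n ih => rw [zpow_sub_one, zpow_sub_one, Homeomorph.mul_apply, ih, hinv]; rfl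

/-- Parallelepipeds of a factor lift. -/
theorem IsFactorMap.exists_lift_parallelepipeds [CompactSpace X] [T2Space Y] {d : ℕ}
    (hπ : IsFactorMap T S π) {w : Cube d → Y} (hw : w ∈ parallelepipeds S d) :
    ∃ v ∈ parallelepipeds T d, (fun ε => π (v ε)) = w := by
  have hcont : Continuous fun (v : Cube d → X) ε => π (v ε) :=
    continuous_pi fun ε => hπ.continuous.comp (continuous_apply ε)
  have hc : IsCompact (parallelepipeds T d) := (isClosed_parallelepipeds T).isCompact
  have : parallelepipeds S d ⊆ (fun (v : Cube d → X) ε => π (v ε)) '' parallelepipeds T d := by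
    refine closure_minimal ?_ (hc.image hcont).isClosed
    rintro _ ⟨n, y, rfl⟩
    obtain ⟨x, rfl⟩ := hπ.surjective y
    exact ⟨_, subset_closure ⟨n, x, rfl⟩, by simp only [hπ.zpow_apply]⟩
  exact this hw

end Factor

/-! ### Gluing parallelepipeds along a common face -/

section Gluing

variable {X : Type*} [MetricSpace X] [CompactSpace X] {T : X ≃ₜ X} {d : ℕ}

/-- Pairs of affine integer vectors on two cubes that agree on the common face in direction `k`. -/
def gluingHom (k : Fin d) : ℤ × (Fin d → ℤ) × ℤ →+ (Cube d ⊕ Cube d → ℤ) :=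
  -- The second base value is the first vector's value at the neighbour of $\mathbf 0$ in direction
  -- `k`, and only the slope in direction `k` may differ; hence the agreement on the common face.
  AddMonoidHom.mk' (fun p => Sum.elim (affineHom d (p.1, p.2.1))
      (affineHom d (p.1 + p.2.1 k, p.2.1 + Pi.single k p.2.2))) fun p q => by
    have h : ∀ a b : ℤ × (Fin d → ℤ), ∀ a' b' : ℤ × (Fin d → ℤ),
        (Sum.elim (affineHom d (a + b)) (affineHom d (a' + b')) : Cube d ⊕ Cube d → ℤ) =
          Sum.elim (affineHom d a) (affineHom d a') + Sum.elim (affineHom d b)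
            (affineHom d b') := fun a b a' b' => by
      funext i
      rcases i with i | i <;> simp
    rw [← h]
    congr 2
    ext
    · simp [add_add_add_comm]
    · simp only [Prod.snd_add, Prod.fst_add, Pi.single_add]
      simp [add_add_add_comm]

/-- Two parallelepipeds with a common face in direction `k` glue along it. -/
theorem glue_mem_parallelepipeds (hmin : IsMinimalSystem T) (hdist : IsDistalSystem T)
    (k : Fin d) {u v : Cube d → X} (hu : u ∈ parallelepipeds T d) (hv : v ∈ parallelepipeds T d)
    (huv : ∀ ε, u (Function.update ε k 1) = v (Function.update ε k 0)) :
    (fun ε => if ε k = 0 then u ε else v ε) ∈ parallelepipeds T d := by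
  let c : Cube d → X := fun _ => u 0
  let φ := gluingHom k
  have hφ : ∀ p ε, φ p (Sum.inr (Function.update ε k 0)) =
      φ p (Sum.inl (Function.update ε k 1)) := fun p ε => by
    simp only [φ, gluingHom, affineHom, AddMonoidHom.mk'_apply, Sum.elim_inl, Sum.elim_inr,
      dotCube_add, dotCube_update, dotCube_single, Function.update_self]
    simp
    ring
  -- move `u` to the constant point
  obtain ⟨W, hW, hWu⟩ : ∃ W ∈ orbitHull T φ (Sum.elim u v), W ∘ Sum.inl = c := by
    have hc : c ∈ orbitHull T (affineHom d) u := by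
      refine mem_orbitHull_symm T _ hdist ?_
      rwa [← hmin.parallelepipeds_eq]
    refine closure_subset_image_orbitHull T φ
      (f := fun W : Cube d ⊕ Cube d → X => W ∘ Sum.inl) (by fun_prop) ?_ hc
    rintro _ ⟨p, rfl⟩
    exact ⟨(p.1, p.2, 0), rfl⟩
  have hWmatch : ∀ ε, W (Sum.inr (Function.update ε k 0)) = u 0 := fun ε => by
    have hcl : IsClosed {W : Cube d ⊕ Cube d → X |
        W (Sum.inr (Function.update ε k 0)) = W (Sum.inl (Function.update ε k 1))} :=
      isClosed_eq (by fun_prop) (by fun_prop)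
    have : W (Sum.inr (Function.update ε k 0)) = W (Sum.inl (Function.update ε k 1)) :=
      orbitHull_subset T φ hcl (fun p => by simp [powAct, hφ, huv]) hW
    rw [this]
    exact congrFun hWu _
  have hWQ : W ∘ Sum.inr ∈ parallelepipeds T d := by
    have hcont : Continuous fun W : Cube d ⊕ Cube d → X => W ∘ Sum.inr := by fun_prop
    refine orbitHull_subset T φ ((isClosed_parallelepipeds T).preimage hcont) (fun p => ?_) hW
    exact powAct_mem_parallelepipeds T hv _
  -- move the second cube to the constant point as well
  have hcc : Sum.elim c c ∈ orbitHull T φ (Sum.elim u v) := by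
    have hc : c ∈ orbitHull T (affineHom d) (W ∘ Sum.inr) := by
      refine mem_orbitHull_symm T _ hdist ?_
      rwa [← hmin.parallelepipeds_eq]
    let Θ : (Cube d → X) → Cube d ⊕ Cube d → X :=
      fun b => Sum.elim (fun ε => b (Function.update ε k 0)) b
    have hΘ : Continuous Θ := continuous_pi fun i => by
      rcases i with i | i
      · exact continuous_apply _
      · exact continuous_apply _
    refine orbitHull_subset T _ (C := Θ ⁻¹' orbitHull T φ (Sum.elim u v))
      (isClosed_closure.preimage hΘ) (fun p => ?_) hc
    -- These parameters give the first cube slope zero in direction `k` while the second cube moves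
    -- by `p`. The first cube of `W` and the lower face of the second are constant, so the result
    -- has the form `Θ b`.
    have := powAct_mem_of_mem_orbitHull T φ hW (p.1, p.2 + Pi.single k (- p.2 k), p.2 k)
    refine (congrArg (· ∈ orbitHull T φ (Sum.elim u v)) ?_).mp this
    funext i
    rcases i with ε | ε
    · have h1 : W (Sum.inl ε) = u 0 := congrFun hWu ε
      simp only [Θ, Sum.elim_inl, powAct, Function.comp_apply, hWmatch, h1]
      congr 2
      simp [φ, gluingHom, affineHom, dotCube_add, dotCube_update, dotCube_single]
    · simp only [Θ, Sum.elim_inr, powAct, Function.comp_apply]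
      congr 2
      simp [φ, gluingHom, affineHom, dotCube_add, dotCube_single]
  -- By symmetry $(u,v)$ is a limit of translates of the constant pair, for which gluing is
  -- explicit.
  have hback := mem_orbitHull_symm T φ hdist hcc
  let Γ : (Cube d ⊕ Cube d → X) → Cube d → X :=
    fun W ε => if ε k = 0 then W (Sum.inl ε) else W (Sum.inr ε)
  have hΓ : Continuous Γ := continuous_pi fun ε => by
    by_cases h : ε k = 0
    · simpa [Γ, h] using continuous_apply _
    · simpa [Γ, h] using continuous_apply _
  refine orbitHull_subset T φ (C := Γ ⁻¹' parallelepipeds T d)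
    (isClosed_closure.preimage hΓ) (fun p => ?_) hback
  -- Gluing adds the two slopes in direction `k`, namely `p.2.1 k` and `p.2.1 k + p.2.2`.
  have hp := powAct_mem_parallelepipeds T (const_mem_parallelepipeds T (d := d) (u 0))
    (p.1, p.2.1 + Pi.single k (p.2.1 k + p.2.2))
  refine (congrArg (· ∈ parallelepipeds T d) ?_).mp hp
  funext ε
  simp only [Γ, powAct, c, φ, gluingHom, affineHom, AddMonoidHom.mk'_apply, Sum.elim_inl,
    Sum.elim_inr, dotCube_add, dotCube_single]
  obtain h | h : ε k = 0 ∨ ε k = 1 := by omega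
  · simp [h]
  · simp only [h]
    simp
    congr 2
    ring

end Gluing

/-! ### Regional proximality and saturation of the set of parallelepipeds -/

section Reindexing

variable {d : ℕ}

/-- The collapse of the cube that keeps only the first `k` directions. -/
def truncCube (k : ℕ) (ε : Cube d) : Cube d :=
  fun i => if (i : ℕ) < k then ε i else 0

theorem dotCube_truncCube (k : ℕ) (n : Fin d → ℤ) (ε : Cube d) :
    dotCube n (truncCube k ε) = dotCube (fun i => if (i : ℕ) < k then n i else 0) ε := by
  refine Finset.sum_congr rfl fun i _ => ?_
  by_cases h : (i : ℕ) < k <;> simp [truncCube, h]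

theorem dotCube_add_vertex (n : Fin d → ℤ) (e ε : Cube d) :
    dotCube n (ε + e) = dotCube (fun i => if e i = 0 then n i else - n i) ε + dotCube n e := by
  rw [dotCube, dotCube, dotCube, ← Finset.sum_add_distrib]
  refine Finset.sum_congr rfl fun i _ => ?_
  obtain h | h : e i = 0 ∨ e i = 1 := by omega
  · simp [h]
  · obtain h' | h' : ε i = 0 ∨ ε i = 1 := by omega
    · simp [h, h']
    · simp [h, h']

theorem vertex_add_self (ε : Cube d) : ε + ε = 0 := by
  funext i
  obtain h | h : ε i = 0 ∨ ε i = 1 := by omega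
  · simp [h]
  · simp [h]

theorem vertex_add_eq_zero_iff {ε e : Cube d} : ε + e = 0 ↔ ε = e := by
  refine ⟨fun h => ?_, fun h => h ▸ vertex_add_self ε⟩
  have := congrArg (· + e) h
  simpa [add_assoc, vertex_add_self] using this

end Reindexing

section RegionallyProximal

variable {X : Type*} [TopologicalSpace X] (T : X ≃ₜ X) (d : ℕ)

/-- The regionally proximal relation of order `d - 1`, in the form `(x, y, …, y) ∈ Q^{[d]}(X)`. -/
def RegProximal (x y : X) : Prop :=
  (fun ε : Cube d => if ε = 0 then x else y) ∈ parallelepipeds T d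

theorem RegProximal.refl (x : X) : RegProximal T d x x := by
  simpa [RegProximal] using const_mem_parallelepipeds T x

theorem isClosed_regProximal : IsClosed {p : X × X | RegProximal T d p.1 p.2} := by
  refine (isClosed_parallelepipeds T).preimage
    (f := fun (p : X × X) (ε : Cube d) => if ε = 0 then p.1 else p.2)
    (continuous_pi fun ε => ?_)
  split_ifs
  · exact continuous_fst
  · exact continuous_snd

variable {T d} in
theorem RegProximal.zpow {x y : X} (h : RegProximal T d x y) (m : ℤ) :
    RegProximal T d ((T ^ m) x) ((T ^ m) y) := by
  have := powAct_mem_parallelepipeds T h (m, 0)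
  refine (congrArg (· ∈ parallelepipeds T d) ?_).mp this
  funext ε
  by_cases h : ε = 0 <;> simp [powAct, affineHom, dotCube_zero, h]

end RegionallyProximal

section Saturation

variable {X : Type*} [MetricSpace X] [CompactSpace X] {T : X ≃ₜ X} {d : ℕ}

/-- Start from $(x,w_{\mathbf 0},\dots,w_{\mathbf 0})$ and restore the true vertices of `w` one
direction at a time, gluing on `w ∘ truncCube (k + 1)` in direction `k`. -/
theorem corner_mem_parallelepipeds (hmin : IsMinimalSystem T) (hdist : IsDistalSystem T)
    {w : Cube d → X} (hw : w ∈ parallelepipeds T d) {x : X} (hx : RegProximal T d x (w 0)) :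
    (fun ε => if ε = 0 then x else w ε) ∈ parallelepipeds T d := by
  have htrunc : ∀ k, w ∘ truncCube k ∈ parallelepipeds T d := fun k =>
    comp_mem_parallelepipeds T (fun n => ⟨0, _, fun ε => by
      rw [dotCube_truncCube, add_zero]⟩) hw
  have key : ∀ k ≤ d, (fun ε => if ε = 0 then x else w (truncCube k ε)) ∈
      parallelepipeds T d := by
    intro k
    induction k with
    | zero =>
      intro _
      have h0 : ∀ ε : Cube d, truncCube 0 ε = 0 := fun ε => by
        funext i
        simp [truncCube]
      simp only [h0]
      exact hx
    | succ k ih =>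
      intro hk
      let j : Fin d := ⟨k, hk⟩
      have hglue := glue_mem_parallelepipeds hmin hdist j (ih (by omega)) (htrunc (k + 1))
        (fun ε => by
          have hne : Function.update ε j 1 ≠ (0 : Cube d) := fun h => by
            simpa using congrFun h j
          rw [if_neg hne, Function.comp_apply]
          congr 1
          funext i
          by_cases hij : i = j
          · subst hij
            simp [truncCube, j]
          · have : (i : ℕ) ≠ k := fun h => hij (Fin.ext h)
            have hiff : (i : ℕ) < k + 1 ↔ (i : ℕ) < k := by omega
            simp [truncCube, Function.update_of_ne hij, hiff])
      refine (congrArg (· ∈ parallelepipeds T d) ?_).mp hglue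
      funext ε
      by_cases hε : ε = 0
      · simp [hε]
      · by_cases hj : ε j = 0
        · simp only [hj, hε, if_true, if_false]
          congr 1
          funext i
          by_cases hij : i = j
          · subst hij
            simp [truncCube, hj]
          · have : (i : ℕ) ≠ k := fun h => hij (Fin.ext h)
            have hiff : (i : ℕ) < k + 1 ↔ (i : ℕ) < k := by omega
            simp [truncCube, hiff]
        · simp [hj, hε]
  have hd : ∀ ε : Cube d, truncCube d ε = ε := fun ε => by
    funext i
    simp [truncCube]
  simpa only [hd] using key d le_rfl

/-- A vertex of a parallelepiped may be replaced by a regionally proximal point. -/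
theorem update_mem_parallelepipeds (hmin : IsMinimalSystem T) (hdist : IsDistalSystem T)
    {w : Cube d → X} (hw : w ∈ parallelepipeds T d) (e : Cube d) {x : X}
    (hx : RegProximal T d x (w e)) : Function.update w e x ∈ parallelepipeds T d := by
  -- Adding `e` modulo 2 is a reflection of the cube that exchanges `e` and $\mathbf 0$.
  have hrefl : ∀ {w : Cube d → X}, w ∈ parallelepipeds T d →
      w ∘ (· + e) ∈ parallelepipeds T d := fun hw =>
    comp_mem_parallelepipeds T (fun n => ⟨_, _, dotCube_add_vertex n e⟩) hw
  have := hrefl (corner_mem_parallelepipeds hmin hdist (hrefl hw) (x := x) (by simpa using hx))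
  refine (congrArg (· ∈ parallelepipeds T d) ?_).mp this
  funext ε
  by_cases h : ε = e
  · simp [h, vertex_add_self]
  · simp [h, vertex_add_eq_zero_iff, add_assoc, vertex_add_self]

/-- The set of parallelepipeds is saturated for the regionally proximal relation. -/
theorem mem_parallelepipeds_of_regProximal (hmin : IsMinimalSystem T) (hdist : IsDistalSystem T)
    {w w' : Cube d → X} (hw : w ∈ parallelepipeds T d)
    (h : ∀ ε, RegProximal T d (w' ε) (w ε)) : w' ∈ parallelepipeds T d := by
  have key : ∀ s : Finset (Cube d), s.piecewise w' w ∈ parallelepipeds T d := by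
    intro s
    induction s using Finset.induction_on with
    | empty => simpa using hw
    | insert e s he ih =>
      rw [Finset.piecewise_insert]
      refine update_mem_parallelepipeds hmin hdist ih e ?_
      rw [Finset.piecewise_eq_of_notMem _ _ _ he]
      exact h e
  simpa using key Finset.univ

theorem RegProximal.symm (hmin : IsMinimalSystem T) (hdist : IsDistalSystem T) {x y : X}
    (h : RegProximal T d x y) : RegProximal T d y x :=
  mem_parallelepipeds_of_regProximal hmin hdist (const_mem_parallelepipeds T y) fun ε => by
    split_ifs
    · exact RegProximal.refl T d y
    · exact h

theorem RegProximal.trans (hmin : IsMinimalSystem T) (hdist : IsDistalSystem T) {x y z : X}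
    (hxy : RegProximal T d x y) (hyz : RegProximal T d y z) : RegProximal T d x z :=
  mem_parallelepipeds_of_regProximal hmin hdist hyz fun ε => by
    split_ifs
    · exact hxy
    · exact RegProximal.refl T d z

/-- The regionally proximal relation as a setoid. -/
def regProximalSetoid (d : ℕ) (hmin : IsMinimalSystem T) (hdist : IsDistalSystem T) :
    Setoid X where
  r := RegProximal T d
  iseqv := ⟨RegProximal.refl T d, RegProximal.symm hmin hdist, RegProximal.trans hmin hdist⟩

end Saturation

/-! ### Parallelepipeds with a fixed vertex and closed face orbits -/

section Fiber

/-- For each basic open `B`, the set of points of `K` whose orbit meets `B` is open, so its frontier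
is nowhere dense. By Baire some `u` avoids all these frontiers: if nearby orbits meet `B`, so does
the orbit of `u`. -/
theorem exists_forall_mem_closure_range {M : Type*} [TopologicalSpace M]
    [SecondCountableTopology M] {κ : Type*} (K : Set M) [BaireSpace K] [Nonempty K]
    {f : κ → M → M} (hf : ∀ n, Continuous (f n)) :
    ∃ u ∈ K, ∀ v, (u, v) ∈ closure {p : M × M | p.1 ∈ K ∧ ∃ n, p.2 = f n p.1} →
      v ∈ closure (range fun n => f n u) := by
  let b := TopologicalSpace.countableBasis M
  have hb := TopologicalSpace.isBasis_countableBasis M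
  let O : Set M → Set K := fun B => {y | ∃ n, f n y ∈ B}
  have hO : ∀ B ∈ b, IsOpen (O B) := fun B hB => by
    have : O B = ⋃ n, (fun y : K => f n y) ⁻¹' B := by
      ext y
      simp [O]
    rw [this]
    exact isOpen_iUnion fun n => (hb.isOpen hB).preimage ((hf n).comp continuous_subtype_val)
  obtain ⟨u, hu⟩ : (⋂ B ∈ b, (frontier (O B))ᶜ).Nonempty := by
    refine (dense_biInter_of_isOpen (fun B hB => isClosed_frontier.isOpen_compl)
      (TopologicalSpace.countable_countableBasis M) fun B hB => ?_).nonempty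
    rw [← interior_eq_empty_iff_dense_compl]
    exact interior_frontier (hO B hB).isClosed_compl |> fun h => by rwa [frontier_compl] at h
  refine ⟨u, u.2, fun v hv => hb.mem_closure_iff.2 fun B hB hvB => ?_⟩
  have huB : u ∈ closure (O B) := by
    rw [closure_subtype, mem_closure_iff]
    intro V hV huV
    obtain ⟨⟨y, z⟩, ⟨hyV, hzB⟩, hyK, n, hn⟩ := mem_closure_iff.1 hv (V ×ˢ B)
      (hV.prod (hb.isOpen hB)) ⟨huV, hvB⟩
    dsimp only at hn hyK hyV hzB
    subst hn
    exact ⟨y, hyV, ⟨y, hyK⟩, ⟨n, hzB⟩, rfl⟩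
  have hnot := mem_iInter₂.1 hu B hB
  rw [(hO B hB).frontier_eq] at hnot
  obtain ⟨n, hn⟩ : u ∈ O B := by
    by_contra h
    exact hnot ⟨huB, h⟩
  exact ⟨_, hn, n, rfl⟩

/-- The cube of dimension `d + 1` with two given opposite faces in the first direction. -/
def joinCube {X : Type*} {d : ℕ} (u v : Cube d → X) : Cube (d + 1) → X :=
  fun ε => if ε 0 = 0 then u (Fin.tail ε) else v (Fin.tail ε)

section Join

variable {X : Type*} {d : ℕ}

theorem joinCube_faces (w : Cube (d + 1) → X) :
    joinCube (fun ε => w (Fin.cons 0 ε)) (fun ε => w (Fin.cons 1 ε)) = w := by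
  funext ε
  obtain h | h : ε 0 = 0 ∨ ε 0 = 1 := by omega
  · simp only [joinCube, h, if_true]
    rw [← h, Fin.cons_self_tail]
  · simp only [joinCube, h]
    rw [if_neg (by decide), ← h, Fin.cons_self_tail]

theorem continuous_joinCube [TopologicalSpace X] :
    Continuous fun p : (Cube d → X) × (Cube d → X) => joinCube p.1 p.2 := by
  refine continuous_pi fun ε => ?_
  simp only [joinCube]
  split_ifs <;> fun_prop

variable [TopologicalSpace X] (T : X ≃ₜ X)

theorem face_mem_parallelepipeds (e : Fin 2) {w : Cube (d + 1) → X}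
    (hw : w ∈ parallelepipeds T (d + 1)) :
    (fun ε : Cube d => w (Fin.cons e ε)) ∈ parallelepipeds T d :=
  comp_mem_parallelepipeds T (f := fun ε : Cube d => (Fin.cons e ε : Cube (d + 1)))
    (fun n => ⟨_, _, fun ε => (dotCube_cons n e ε).trans (add_comm _ _)⟩) hw

theorem joinCube_diag_mem_parallelepipeds {u v : Cube d → X} (hu : u ∈ parallelepipeds T d)
    (hv : v ∈ orbitHull T (diagHom _) u) : joinCube u v ∈ parallelepipeds T (d + 1) := by
  refine orbitHull_subset T _ (C := joinCube u ⁻¹' parallelepipeds T (d + 1))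
    (isClosed_closure.preimage (continuous_joinCube.comp (by fun_prop : Continuous
      fun v : Cube d → X => (u, v)))) (fun m => ?_) hv
  have hcont : Continuous fun u : Cube d → X => joinCube u (powAct T (diagHom _ m) u) :=
    continuous_joinCube.comp (continuous_id.prodMk (continuous_powAct T _))
  have : parallelepipeds T d ⊆ (fun u : Cube d → X => joinCube u (powAct T (diagHom _ m) u)) ⁻¹'
      parallelepipeds T (d + 1) := by
    refine closure_minimal ?_ (isClosed_closure.preimage hcont)
    rintro _ ⟨n, x, rfl⟩
    refine subset_closure ⟨Fin.cons m n, x, ?_⟩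
    rw [← joinCube_faces fun ε : Cube (d + 1) => (T ^ dotCube (Fin.cons m n) ε) x]
    simp [dotCube_cons, diagHom, zpow_add]
    rfl
  exact this hu

theorem joinCube_powAct_faceHom (u v : Cube d → X) (m : ℤ) (n : Fin d → ℤ) :
    powAct T (faceHom (d + 1) (Fin.cons m n)) (joinCube u v) =
      joinCube (powAct T (faceHom d n) u)
        (powAct T (diagHom _ m) (powAct T (faceHom d n) v)) := by
  rw [← joinCube_faces (powAct T _ _)]
  simp [powAct, faceHom, diagHom, dotCube_cons, zpow_add]
  rfl

/-- Opposite faces of a parallelepiped are limits of pairs related by a diagonal power of `T`; this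
is the closure to which the category argument applies. -/
theorem parallelepipeds_succ_subset : parallelepipeds T (d + 1) ⊆
    {w | ((fun ε => w (Fin.cons 0 ε)), (fun ε => w (Fin.cons 1 ε))) ∈
      closure {p : (Cube d → X) × (Cube d → X) |
        p.1 ∈ parallelepipeds T d ∧ ∃ m, p.2 = powAct T (diagHom _ m) p.1}} := by
  refine closure_minimal ?_ (isClosed_closure.preimage (by fun_prop))
  rintro _ ⟨n, x, rfl⟩
  refine subset_closure ⟨subset_closure ⟨fun i => n i.succ, x, ?_⟩, n 0, ?_⟩
  · simp [dotCube_cons]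
  · simp [dotCube_cons, diagHom, zpow_add]
    rfl

end Join

variable {X : Type*} [MetricSpace X] [CompactSpace X] {T : X ≃ₜ X}

/-- Above every point there is a parallelepiped whose neighbours along a new direction all lie
in its closed orbit under the diagonal transformation. -/
theorem exists_parallelepiped_forall_mem_orbitHull_diagHom (hmin : IsMinimalSystem T)
    (hdist : IsDistalSystem T) (d : ℕ) (x : X) :
    ∃ u ∈ parallelepipeds T d, u 0 = x ∧
      ∀ v, joinCube u v ∈ parallelepipeds T (d + 1) → v ∈ orbitHull T (diagHom _) u := by
  have : CompactSpace (parallelepipeds T d) :=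
    isCompact_iff_compactSpace.1 (isClosed_parallelepipeds T).isCompact
  have : Nonempty (parallelepipeds T d) := ⟨⟨_, const_mem_parallelepipeds T x⟩⟩
  obtain ⟨u₀, hu₀, hgood⟩ := exists_forall_mem_closure_range (parallelepipeds T d)
    (f := fun m : ℤ => powAct T (diagHom (Cube d) m)) fun m => continuous_powAct T _
  -- The generic `u₀` need not have vertex `x`; minimality supplies such a point in its diagonal
  -- orbit closure.
  obtain ⟨u, hu, hux⟩ : ∃ u ∈ orbitHull T (diagHom _) u₀, u 0 = x := by
    refine closure_subset_image_orbitHull T (diagHom _) (f := fun u : Cube d → X => u 0)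
      (A := range fun m : ℤ => (T ^ m) (u₀ 0)) (by fun_prop) ?_ (by rw [hmin]; trivial)
    rintro _ ⟨m, rfl⟩
    exact ⟨m, rfl⟩
  have hjoin := joinCube_diag_mem_parallelepipeds T hu₀ hu
  refine ⟨u, ?_, hux, fun v hv => ?_⟩
  · have := face_mem_parallelepipeds T 1 hjoin
    simpa [joinCube] using this
  · have hglue : joinCube u₀ v ∈ parallelepipeds T (d + 1) := by
      have := glue_mem_parallelepipeds hmin hdist 0 hjoin hv fun ε => by
        simp [joinCube]
      refine (congrArg (· ∈ parallelepipeds T (d + 1)) ?_).mp this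
      funext ε
      by_cases h : ε 0 = 0 <;> simp [joinCube, h]
    have hv₀ : v ∈ orbitHull T (diagHom _) u₀ := by
      refine hgood v ?_
      have := parallelepipeds_succ_subset T hglue
      simpa [joinCube] using this
    exact orbitHull_trans T _ (mem_orbitHull_symm T _ hdist hu) hv₀

/-- In a minimal distal system the parallelepipeds based at `x` form the closed orbit of the
constant point under the face group. -/
theorem mem_orbitHull_faceHom (hmin : IsMinimalSystem T) (hdist : IsDistalSystem T) {d : ℕ}
    {w : Cube d → X} (hw : w ∈ parallelepipeds T d) :
    w ∈ orbitHull T (faceHom d) fun _ => w 0 := by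
  induction d with
  | zero =>
    have : (fun _ => w 0) = w := funext fun ε => congrArg w (Subsingleton.elim _ _)
    rw [this]
    exact self_mem_orbitHull T _ w
  | succ d ih =>
    -- It suffices to bring `w` to the constant point: the lower face is first moved to the special
    -- `u`, then the upper face to `u`, then both faces together to the constant.
    refine mem_orbitHull_symm T _ hdist ?_
    obtain ⟨u, hu, hux, hgood⟩ :=
      exists_parallelepiped_forall_mem_orbitHull_diagHom hmin hdist d (w 0)
    have hu' := ih hu
    rw [hux] at hu'
    let lo : (Cube (d + 1) → X) → Cube d → X := fun w ε => w (Fin.cons 0 ε)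
    have hlo : Continuous lo := by fun_prop
    have hlow : lo w ∈ orbitHull T (faceHom d) fun _ => w 0 := by
      have h0 : lo w 0 = w 0 := congrArg w (by
        funext i
        refine Fin.cases ?_ (fun i => ?_) i <;> simp)
      exact h0 ▸ ih (face_mem_parallelepipeds T 0 hw)
    have hlou : u ∈ orbitHull T (faceHom d) (lo w) :=
      orbitHull_trans T _ (mem_orbitHull_symm T _ hdist hlow) hu'
    obtain ⟨w₁, hw₁, hw₁u⟩ : ∃ w₁ ∈ orbitHull T (faceHom (d + 1)) w, lo w₁ = u := by
      refine closure_subset_image_orbitHull T _ hlo ?_ hlou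
      rintro _ ⟨n, rfl⟩
      -- With first entry 0 the vector acts identically on both faces.
      refine ⟨Fin.cons 0 n, ?_⟩
      simp [lo, powAct, faceHom, dotCube_cons]
      rfl
    have hw₁Q : w₁ ∈ parallelepipeds T (d + 1) :=
      orbitHull_affineHom_subset T hw (orbitHull_faceHom_subset_affineHom T _ hw₁)
    obtain ⟨v, rfl⟩ : ∃ v, joinCube u v = w₁ := ⟨_, by
      rw [← hw₁u]
      exact joinCube_faces w₁⟩
    have hvu : u ∈ orbitHull T (diagHom _) v := mem_orbitHull_symm T _ hdist (hgood v hw₁Q)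
    -- The face transformation in direction 0 fixes the lower face and acts diagonally on the upper
    -- one.
    have huu : joinCube u u ∈ orbitHull T (faceHom (d + 1)) (joinCube u v) := by
      refine orbitHull_subset T _ (C := joinCube u ⁻¹' orbitHull T (faceHom (d + 1))
        (joinCube u v)) (isClosed_closure.preimage (continuous_joinCube.comp (by fun_prop :
          Continuous fun v : Cube d → X => (u, v)))) (fun m => ?_) hvu
      have := powAct_mem_orbitHull T (faceHom (d + 1)) (Fin.cons m 0) (joinCube u v)
      rw [joinCube_powAct_faceHom, map_zero, powAct_zero, powAct_zero] at this
      exact this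
    have hconst : (fun _ => w 0) ∈ orbitHull T (faceHom (d + 1)) (joinCube u u) := by
      have := orbitHull_subset T _ (C := (fun z => joinCube z z) ⁻¹' orbitHull T (faceHom (d + 1))
        (joinCube u u)) (isClosed_closure.preimage (continuous_joinCube.comp (by fun_prop :
          Continuous fun v : Cube d → X => (v, v)))) (fun n => ?_)
        (mem_orbitHull_symm T _ hdist hu')
      · have hj : joinCube (fun _ => w 0) (fun _ : Cube d => w 0) = fun _ => w 0 :=
          funext fun ε => ite_self _
        exact hj ▸ this
      · have := powAct_mem_orbitHull T (faceHom (d + 1)) (Fin.cons 0 n) (joinCube u u)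
        rw [joinCube_powAct_faceHom, map_zero, powAct_zero] at this
        exact this
    exact orbitHull_trans T _ hw₁ (orbitHull_trans T _ huu hconst)

end Fiber

/-! ### Quotients of compact metrizable spaces by closed equivalence relations -/

section Quotient

variable {X W : Type*} [TopologicalSpace X] [TopologicalSpace W] {φ : X → W}

theorem t2Space_of_isClosedMap [CompactSpace X] [T2Space X]
    (hsurj : Function.Surjective φ) (hcl : IsClosedMap φ) (hfib : ∀ w, IsClosed (φ ⁻¹' {w})) :
    T2Space W := by
  refine ⟨fun a b hab => ?_⟩
  obtain ⟨U, V, hU, hV, haU, hbV, hUV⟩ := SeparatedNhds.of_isCompact_isCompact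
    (hfib a).isCompact (hfib b).isCompact (Disjoint.preimage φ (disjoint_singleton.2 hab))
  refine ⟨(φ '' Uᶜ)ᶜ, (φ '' Vᶜ)ᶜ, (hcl _ hU.isClosed_compl).isOpen_compl,
    (hcl _ hV.isClosed_compl).isOpen_compl, ?_, ?_, disjoint_left.2 fun w hw hw' => ?_⟩
  · rintro ⟨x, hx, rfl⟩
    exact hx (haU rfl)
  · rintro ⟨x, hx, rfl⟩
    exact hx (hbV rfl)
  · obtain ⟨x, rfl⟩ := hsurj w
    have hxU : x ∈ U := by
      by_contra h
      exact hw ⟨x, h, rfl⟩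
    have hxV : x ∈ V := by
      by_contra h
      exact hw' ⟨x, h, rfl⟩
    exact disjoint_left.1 hUV hxU hxV

/-- The basis consists of the sets of points whose whole fibre lies in a given finite union of basic
open sets; finite unions suffice because fibres are compact. -/
theorem secondCountableTopology_of_isClosedMap [SecondCountableTopology X] (hφ : Continuous φ)
    (hsurj : Function.Surjective φ) (hcl : IsClosedMap φ)
    (hfib : ∀ w, IsCompact (φ ⁻¹' {w})) : SecondCountableTopology W := by
  let b := TopologicalSpace.countableBasis X
  have hb := TopologicalSpace.isBasis_countableBasis X
  let B : Set (Set W) := (fun s : Set (Set X) => (φ '' (⋃₀ s)ᶜ)ᶜ) '' {s | s.Finite ∧ s ⊆ b}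
  have hB : TopologicalSpace.IsTopologicalBasis B := by
    refine TopologicalSpace.isTopologicalBasis_of_isOpen_of_nhds ?_ ?_
    · rintro _ ⟨s, ⟨-, hs⟩, rfl⟩
      exact (hcl _ (isOpen_sUnion fun t ht => hb.isOpen (hs ht)).isClosed_compl).isOpen_compl
    · intro w U hwU hU
      have hsub : φ ⁻¹' {w} ⊆ φ ⁻¹' U := preimage_mono (singleton_subset_iff.2 hwU)
      obtain ⟨t, ht⟩ := (hfib w).elim_finite_subcover
        (fun s : {s : Set X // s ∈ b ∧ s ⊆ φ ⁻¹' U} => s.1) (fun s => hb.isOpen s.2.1)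
        (fun x hx => by
          obtain ⟨s, hs, hxs, hsU⟩ := hb.exists_subset_of_mem_open (hsub hx) (hU.preimage hφ)
          exact mem_iUnion.2 ⟨⟨s, hs, hsU⟩, hxs⟩)
      refine ⟨_, ⟨Subtype.val '' (t : Set {s : Set X // s ∈ b ∧ s ⊆ φ ⁻¹' U}), ⟨(Finset.finite_toSet t).image _, ?_⟩, rfl⟩, ?_, ?_⟩
      · rintro _ ⟨s, -, rfl⟩
        exact s.2.1
      · rintro ⟨x, hx, rfl⟩
        obtain ⟨s, hs, hxs⟩ := mem_iUnion₂.1 (ht (show x ∈ φ ⁻¹' {φ x} from rfl))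
        exact hx ⟨s, ⟨s, hs, rfl⟩, hxs⟩
      · intro v hv
        obtain ⟨x, rfl⟩ := hsurj v
        by_contra hxU
        refine hv ⟨x, ?_, rfl⟩
        rintro ⟨_, ⟨s, -, rfl⟩, hxs⟩
        exact hxU (s.2.2 hxs)
  exact hB.secondCountableTopology
    ((countable_ofPred_finite_subset (TopologicalSpace.countable_countableBasis X)).image _)

theorem isClosedMap_quotientMk [CompactSpace X] (s : Setoid X)
    (hs : IsClosed {p : X × X | s p.1 p.2}) : IsClosedMap (Quotient.mk s) := by
  intro C hC
  rw [← (isQuotientMap_quotient_mk' (s := s)).isClosed_preimage]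
  change IsClosed (Quotient.mk s ⁻¹' (Quotient.mk s '' C))
  have : Quotient.mk s ⁻¹' (Quotient.mk s '' C) =
      Prod.snd '' ({p : X × X | s p.1 p.2} ∩ Prod.fst ⁻¹' C) := by
    ext y
    constructor
    · rintro ⟨x, hx, hxy⟩
      exact ⟨(x, y), ⟨Quotient.exact hxy, hx⟩, rfl⟩
    · rintro ⟨⟨x, y⟩, ⟨hxy, hx⟩, rfl⟩
      exact ⟨x, hx, Quotient.sound hxy⟩
  rw [this]
  exact isClosedMap_snd_of_compactSpace _ (hs.inter (hC.preimage continuous_fst))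

end Quotient

/-! ### The face groups as groups of integer vectors -/

section FaceGroup

variable {X : Type*} [TopologicalSpace X] (T : X ≃ₜ X) {d : ℕ}

/-- The group generated by the face transformations acts through the vectors `n · ε`. -/
theorem setOf_closure_faceMaps_eq {ι : Type*} (c : ι → Cube d) (z : ι → X) :
    {w | ∃ g ∈ Subgroup.closure (range fun j : Fin d =>
      Homeomorph.piCongrRight fun i => if c i j = 1 then T else Homeomorph.refl X), w = g z} =
      range fun n : Fin d → ℤ => powAct T (fun i => dotCube n (c i)) z := by
  have hgen : ∀ (j : Fin d) (z : ι → X), (Homeomorph.piCongrRight fun i =>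
      if c i j = 1 then T else Homeomorph.refl X) z =
        powAct T (fun i => dotCube (Pi.single j 1) (c i)) z := fun j z => by
    funext i
    simp only [powAct, dotCube_single, Homeomorph.piCongrRight_apply]
    obtain h | h : c i j = 0 ∨ c i j = 1 := by omega
    · simp [h]
    · simp [h]
  have hadd : ∀ (n m : Fin d → ℤ) (z : ι → X), powAct T (fun i => dotCube (n + m) (c i)) z =
      powAct T (fun i => dotCube n (c i)) (powAct T (fun i => dotCube m (c i)) z) :=
    fun n m z => by
      rw [← powAct_add]
      congr 1
      funext i
      exact dotCube_add n m _
  have hzero : ∀ z : ι → X, powAct T (fun i => dotCube (0 : Fin d → ℤ) (c i)) z = z :=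
    fun z => by
      funext i
      simp [powAct, dotCube_zero]
  ext w
  constructor
  · rintro ⟨g, hg, rfl⟩
    suffices ∃ n : Fin d → ℤ, ∀ z, g z = powAct T (fun i => dotCube n (c i)) z by
      obtain ⟨n, hn⟩ := this
      exact ⟨n, (hn z).symm⟩
    induction hg using Subgroup.closure_induction with
    | mem g hg =>
      obtain ⟨j, rfl⟩ := hg
      exact ⟨_, hgen j⟩
    | one => exact ⟨0, fun z => (hzero z).symm⟩
    | mul g h _ _ ihg ihh =>
      obtain ⟨n, hn⟩ := ihg
      obtain ⟨m, hm⟩ := ihh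
      exact ⟨n + m, fun z => by rw [hadd, ← hm, ← hn]; rfl⟩
    | inv g _ ih =>
      obtain ⟨n, hn⟩ := ih
      refine ⟨-n, fun z => ?_⟩
      apply g.injective
      refine (g.apply_symm_apply z).trans ?_
      rw [hn, ← hadd, add_neg_cancel, hzero]
  · rintro ⟨n, rfl⟩
    let H := Subgroup.closure (range fun j : Fin d =>
      Homeomorph.piCongrRight fun i => if c i j = 1 then T else Homeomorph.refl X)
    let A : AddSubgroup (Fin d → ℤ) :=
      { carrier := {n | ∃ g ∈ H, ∀ z, powAct T (fun i => dotCube n (c i)) z = g z}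
        zero_mem' := ⟨1, H.one_mem, hzero⟩
        add_mem' := by
          rintro n m ⟨g, hg, hn⟩ ⟨h, hh, hm⟩
          exact ⟨g * h, H.mul_mem hg hh, fun z => by rw [hadd, hm, hn]; rfl⟩
        neg_mem' := by
          rintro n ⟨g, hg, hn⟩
          refine ⟨g⁻¹, H.inv_mem hg, fun z => ?_⟩
          apply g.injective
          rw [← hn, ← hadd, add_neg_cancel, hzero]
          exact (g.apply_symm_apply z).symm }
    have hA : n ∈ A := by
      rw [← Finset.univ_sum_single n]
      refine A.sum_mem fun j _ => ?_
      have hj : Pi.single j (n j) = n j • (Pi.single j 1 : Fin d → ℤ) := by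
        rw [← Pi.single_smul]
        simp
      have hmem : (Pi.single j 1 : Fin d → ℤ) ∈ A :=
        ⟨_, Subgroup.subset_closure ⟨j, rfl⟩, fun z => (hgen j z).symm⟩
      rw [hj]
      exact zsmul_mem hmem _
    obtain ⟨g, hg, h⟩ := hA
    exact ⟨g, hg, h z⟩

theorem faceOrbitClosure_eq (x : X) :
    faceOrbitClosure T d x = orbitHull T (faceHom d) fun _ => x :=
  congrArg closure (setOf_closure_faceMaps_eq T (fun ε : Cube d => ε) fun _ => x)

theorem faceOrbitClosureStar_eq (x : X) : faceOrbitClosureStar T d x =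
    closure (range fun n : Fin d → ℤ =>
      powAct T (fun ε : CubeStar d => dotCube n ε.1) fun _ => x) :=
  congrArg closure (setOf_closure_faceMaps_eq T (fun ε : CubeStar d => ε.1) fun _ => x)

end FaceGroup

/-! ### The quotient by regional proximality and the maximal factor -/

section MaximalFactor

theorem IsMinimalSystem.isTransitiveSystem {X : Type*} [TopologicalSpace X] {T : X ≃ₜ X}
    (hmin : IsMinimalSystem T) : IsTransitiveSystem T := by
  rintro U V - hV ⟨x, hx⟩ ⟨y, hy⟩
  obtain ⟨_, hv, n, rfl⟩ := mem_closure_iff.1 (by rw [hmin x]; trivial : y ∈ _) V hV hy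
  exact ⟨n, x, hx, hv⟩

theorem IsFactorMap.isMinimalSystem {X Y : Type*} [TopologicalSpace X] [TopologicalSpace Y]
    {T : X ≃ₜ X} {S : Y ≃ₜ Y} {π : X → Y} (hπ : IsFactorMap T S π) (hmin : IsMinimalSystem T) :
    IsMinimalSystem S := by
  intro y
  obtain ⟨x, rfl⟩ := hπ.surjective y
  refine eq_univ_of_forall fun y' => ?_
  obtain ⟨x', rfl⟩ := hπ.surjective y'
  have : closure (range fun n : ℤ => (T ^ n) x) ⊆
      π ⁻¹' closure (range fun n : ℤ => (S ^ n) (π x)) :=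
    closure_minimal (by rintro _ ⟨n, rfl⟩; exact subset_closure ⟨n, (hπ.zpow_apply n x).symm⟩)
      (isClosed_closure.preimage hπ.continuous)
  exact this (by rw [hmin x]; trivial)

universe u v

variable {X : Type u} [MetricSpace X] [CompactSpace X] {T : X ≃ₜ X}

/-- The quotient of a minimal distal system by the regionally proximal relation of order `k` is
a system of order `k`. -/
theorem exists_factor_of_order (hmin : IsMinimalSystem T) (hdist : IsDistalSystem T) (k : ℕ) :
    ∃ (W : Type u) (_ : MetricSpace W) (_ : CompactSpace W) (R : W ≃ₜ W) (φ : X → W),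
      IsFactorMap T R φ ∧ IsSystemOfOrder R k ∧
        ∀ x y, φ x = φ y → RegProximal T (k + 1) x y := by
  let s := regProximalSetoid (k + 1) hmin hdist
  have hcont : Continuous (Quotient.mk s) := continuous_quot_mk
  have hsurj : Function.Surjective (Quotient.mk s) := Quotient.mk_surjective
  have hcl : IsClosedMap (Quotient.mk s) := isClosedMap_quotientMk s (isClosed_regProximal T _)
  have hfib : ∀ w, IsClosed (Quotient.mk s ⁻¹' {w}) := fun w => by
    obtain ⟨x, rfl⟩ := hsurj w
    have h1 := hcl {x} isClosed_singleton
    rw [image_singleton] at h1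
    exact h1.preimage hcont
  have : T2Space (Quotient s) := t2Space_of_isClosedMap hsurj hcl hfib
  have : SecondCountableTopology (Quotient s) :=
    secondCountableTopology_of_isClosedMap hcont hsurj hcl fun w => (hfib w).isCompact
  have hmap : ∀ n : ℤ, Continuous (Quotient.map (sa := s) (sb := s) (⇑(T ^ n))
      fun _ _ h => RegProximal.zpow h n) := fun n =>
    (hcont.comp (T ^ n).continuous).quotient_lift _
  let R : Quotient s ≃ₜ Quotient s :=
    { toFun := Quotient.map (⇑(T ^ (1 : ℤ))) fun _ _ h => RegProximal.zpow h 1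
      invFun := Quotient.map (⇑(T ^ (-1 : ℤ))) fun _ _ h => RegProximal.zpow h (-1)
      left_inv := fun w => by
        obtain ⟨x, rfl⟩ := hsurj w
        simp [Quotient.map_mk]
      right_inv := fun w => by
        obtain ⟨x, rfl⟩ := hsurj w
        simp [Quotient.map_mk]
      continuous_toFun := hmap 1
      continuous_invFun := hmap (-1) }
  let _ : MetricSpace (Quotient s) := TopologicalSpace.metrizableSpaceMetric (Quotient s)
  have hφ : IsFactorMap T R (Quotient.mk s) := ⟨hcont, hsurj, fun x => by
    simp [R, Quotient.map_mk]⟩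
  refine ⟨Quotient s, inferInstance, inferInstance, R, Quotient.mk s, hφ,
    ⟨(hφ.isMinimalSystem hmin).isTransitiveSystem, ?_⟩, fun x y h => Quotient.exact h⟩
  intro a b hab
  obtain ⟨x, rfl⟩ := hsurj a
  obtain ⟨y, rfl⟩ := hsurj b
  -- The lift `w` agrees with $(x,y,\dots,y)$ only up to regional proximality at each vertex, which
  -- saturation absorbs.
  obtain ⟨w, hw, hwab⟩ := hφ.exists_lift_parallelepipeds hab
  refine Quotient.sound (mem_parallelepipeds_of_regProximal hmin hdist hw fun ε => ?_)
  refine Quotient.exact (s := s) ?_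
  rw [congrFun hwab ε]
  split_ifs <;> rfl

/-- The quotient by regional proximality has order `k`, so its quotient map factors through `π`. -/
theorem IsMaximalFactorOfOrder.regProximal {Z : Type v} [MetricSpace Z] {S : Z ≃ₜ Z}
    {π : X → Z} {k : ℕ} (hπ : IsMaximalFactorOfOrder T S π k) (hmin : IsMinimalSystem T)
    (hdist : IsDistalSystem T) {x y : X} (h : π x = π y) : RegProximal T (k + 1) x y := by
  obtain ⟨W, _, _, R, φ, hφ, hR, hker⟩ := exists_factor_of_order hmin hdist k
  obtain ⟨ψ, -, rfl⟩ := hπ.2.2 W R φ hφ hR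
  exact hker x y (congrArg ψ h)

end MaximalFactor

/-! ### Closed face orbits as preimages, and the conclusion -/

/-- Prescribing the coordinate at `(0, …, 0)`. -/
def cornerCons {X : Type*} {d : ℕ} (x : X) (z : CubeStar d → X) : Cube d → X :=
  fun ε => if h : ε = 0 then x else z ⟨ε, h⟩

theorem continuous_cornerCons {X : Type*} [TopologicalSpace X] {d : ℕ} (x : X) :
    Continuous (cornerCons x : (CubeStar d → X) → Cube d → X) := by
  refine continuous_pi fun ε => ?_
  by_cases h : ε = 0
  · simpa [cornerCons, h] using continuous_const
  · simpa [cornerCons, h] using continuous_apply _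

theorem starProj_cornerCons {X : Type*} {d : ℕ} (x : X) (z : CubeStar d → X) :
    starProj (cornerCons x z) = z := by
  funext ε
  simp [starProj, cornerCons, ε.2]

theorem faceOrbitClosure_eq_singletonProd {X Z : Type*} [MetricSpace X] [CompactSpace X]
    [MetricSpace Z] {T : X ≃ₜ X} {S : Z ≃ₜ Z} {π : X → Z} {k : ℕ}
    (hmin : IsMinimalSystem T) (hdist : IsDistalSystem T) (hπ : IsMaximalFactorOfOrder T S π k)
    (x : X) : faceOrbitClosure T (k + 1) x =
      singletonProd x (starMap π (k + 1) ⁻¹' faceOrbitClosureStar S (k + 1) (π x)) := by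
  rw [faceOrbitClosure_eq, faceOrbitClosureStar_eq]
  apply Subset.antisymm
  · have hcont : Continuous fun z : Cube (k + 1) → X => starMap π (k + 1) (starProj z) :=
      continuous_pi fun ε => hπ.1.continuous.comp (continuous_apply _)
    refine orbitHull_subset T _ (C := {z | z 0 = x ∧ _}) ((isClosed_eq (continuous_apply 0)
      continuous_const).and (isClosed_closure.preimage hcont)) fun n => ⟨?_, ?_⟩
    · simp [powAct, faceHom, dotCube_vertex_zero]
    · refine subset_closure ⟨n, ?_⟩
      funext ε
      exact (hπ.1.zpow_apply _ x).symm
  · rintro z ⟨rfl, hz⟩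
    refine mem_orbitHull_faceHom hmin hdist ?_
    have hmem : cornerCons (π (z 0)) (starMap π (k + 1) (starProj z)) ∈
        parallelepipeds S (k + 1) := by
      have hsub := closure_minimal (s := range fun n : Fin (k + 1) → ℤ =>
          powAct S (fun ε : CubeStar (k + 1) => dotCube n ε.1) fun _ => π (z 0))
        (t := cornerCons (π (z 0)) ⁻¹' parallelepipeds S (k + 1)) ?_
        (isClosed_closure.preimage (continuous_cornerCons _))
      · exact hsub hz
      · rintro _ ⟨n, rfl⟩
        refine subset_closure ⟨n, π (z 0), ?_⟩
        funext ε
        by_cases h : ε = 0 <;> simp [cornerCons, powAct, h, dotCube_vertex_zero]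
    obtain ⟨w, hw, hwz⟩ := hπ.1.exists_lift_parallelepipeds hmem
    -- The lift `w` and `z` have equal `π`-images at every vertex.
    refine mem_parallelepipeds_of_regProximal hmin hdist hw fun ε =>
      hπ.regProximal hmin hdist ?_
    rw [congrFun hwz ε]
    by_cases h : ε = 0 <;> simp [cornerCons, h, starMap, starProj]

theorem isSaturated_starProj_image_singletonProd {X Z : Type*} {π : X → Z} {d : ℕ} (x : X)
    (B : Set (CubeStar d → Z)) :
    IsSaturated (starMap π d) (starProj '' singletonProd x (starMap π d ⁻¹' B)) := by
  have : starProj '' singletonProd x (starMap π d ⁻¹' B) = starMap π d ⁻¹' B := by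
    ext z
    constructor
    · rintro ⟨w, hw, rfl⟩
      exact hw.2
    · intro hz
      refine ⟨cornerCons x z, ⟨by simp [cornerCons], ?_⟩, starProj_cornerCons x z⟩
      rwa [starProj_cornerCons]
  rw [this]
  exact (preimage_image_preimage).symm

end CubicDyn

theorem corollary3 {X Z : Type*} [MetricSpace X] [CompactSpace X] [MetricSpace Z] [CompactSpace Z]
    (T : X ≃ₜ X) (S : Z ≃ₜ Z) (π : X → Z) (d : ℕ) (hd : 1 ≤ d)
    (hmin : CubicDyn.IsMinimalSystem T) (hdist : CubicDyn.IsDistalSystem T)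
    (hπ : CubicDyn.IsMaximalFactorOfOrder T S π (d - 1)) :
    (∀ x : X, CubicDyn.faceOrbitClosure T d x =
      CubicDyn.singletonProd x
        (CubicDyn.starMap π d ⁻¹' CubicDyn.faceOrbitClosureStar S d (π x))) ∧
    (∀ x : X, CubicDyn.IsSaturated (CubicDyn.starMap π d)
      (CubicDyn.starProj '' CubicDyn.faceOrbitClosure T d x)) ∧
    CubicDyn.IsCubicCharacteristicFactor T S π d := by
  obtain ⟨k, rfl⟩ : ∃ k, d = k + 1 := ⟨d - 1, by omega⟩
  have horbit : ∀ x : X, CubicDyn.faceOrbitClosure T (k + 1) x = CubicDyn.singletonProd x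
      (CubicDyn.starMap π (k + 1) ⁻¹' CubicDyn.faceOrbitClosureStar S (k + 1) (π x)) :=
    CubicDyn.faceOrbitClosure_eq_singletonProd hmin hdist hπ
  have hsat : ∀ x : X, CubicDyn.IsSaturated (CubicDyn.starMap π (k + 1))
      (CubicDyn.starProj '' CubicDyn.faceOrbitClosure T (k + 1) x) := fun x => by
    rw [horbit x]
    exact CubicDyn.isSaturated_starProj_image_singletonProd x _
  exact ⟨horbit, hsat, hπ.1, Set.univ, IsGδ.univ, dense_univ, fun x _ => hsat x⟩
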